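/- **Setting.** Let $\mathbb A_j,\mathbb B_j$ ($j\in\mathbb Z$) be non-empty Polish spaces with their Borel $\sigma$-algebras, and let $n,L,N\ge 0$ be integers. Write $a^i=(\dots,a_{-1},a_0,\dots,a_i)$, $a_k^m=(a_k,\dots,a_m)$, and similarly for $b$. Let $\nu$ be a probability measure (the law of the initial data $(a^{-1},b^{-1})$), and let a channel $C_i(db_i|b^{i-1},a^i)$, $i=0,\dots,n$, be given by stochastic kernels. Fix a convention on the initial data: the encoder knows $b^{-1}$ and either all of $a^{-1}$ or $a_{-m}^{-1}$ for some fixed $m\ge 0$ (for instance $(a_{-L}^{-1},b^{-1})$, $m=L$, or only $b^{-1}$, $m=0$). Below, input symbols with negative index on which $P_i$ or $\pi_i$ depends are only those known to the encoder. $\mathcal P_{[0,n]}$ is the set of all families of stochastic kernels $P_i(da_i|a^{i-1},b^{i-1})$, $i=0,\dots,n$. Such a $P$ induces the joint laws $$\mathbf P^P(da^i,db^i)=\nu(da^{-1},db^{-1})\otimes\bigotimes_{j=0}^i\big(P_j(da_j|a^{j-1},b^{j-1})\otimes C_j(db_j|b^{j-1},a^j)\big),$$ the conditional distributions $\Pi_i^P(db_i|b^{i-1})$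 of $B_i$ given $B^{i-1}$, and the directed information $$I^P(A^n\to B^n)=\sum_{i=0}^n\mathbf E^P\Big\{\log\frac{dC_i(\cdot|B^{i-1},A^i)}{d\Pi_i^P(\cdot|B^{i-1})}(B_i)\Big\}=\sum_{i=0}^n\mathbf E^P\Big\{D\big(C_i(\cdot|B^{i-1},A^i)\,\big\|\,\Pi_i^P(\cdot|B^{i-1})\big)\Big\}\in[0,\infty],$$ where $D$ is relative entropy ($=\infty$ in the absence of absolute continuity). Suppose that the channel is of Class A: there are stochastic kernels $Q_i(db_i|b^{i-1},a_{i-L}^i)$ such that, under every $P\in\mathcal P_{[0,n]}$, $C_i(\cdot|b^{i-1},a^i)=Q_i(\cdot|b^{i-1},a_{i-L}^i)$ for almost all $(b^{i-1},a^i)$, $i=0,\dots,n$. For $J\ge 0$ let $\overline{\mathcal P}^{J}\subset\mathcal P_{[0,n]}$ be the set of those $P$ for which there are kernels $\pi_i(da_i|a_{i-J}^{i-1},b^{i-1})$ with $P_i(\cdot|a^{i-1},b^{i-1})=\pi_i(\cdot|a_{i-J}^{i-1},b^{i-1})$ for $\mathbf P^P$-almost all $(a^{i-1},b^{i-1})$,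 $i=0,\dots,n$. **Theorem.** **(a) Without transmission cost.** The maximization of $I^P(A^n\to B^n)$ over $\mathcal P_{[0,n]}$ occurs in $\overline{\mathcal P}^{L}$: for every $P\in\mathcal P_{[0,n]}$ there is $P'\in\overline{\mathcal P}^{L}$ with $I^{P}(A^n\to B^n)\le I^{P'}(A^n\to B^n)$; in particular, if a maximizer over $\mathcal P_{[0,n]}$ exists, then one exists in $\overline{\mathcal P}^{L}$. Moreover $$\sup_{P\in\mathcal P_{[0,n]}}I^P(A^n\to B^n)=\sup_{\{\pi_i(da_i|a_{i-L}^{i-1},b^{i-1})\}_{i=0}^n}\ \sum_{i=0}^n\mathbf E^{\pi}\Big\{\log\frac{dQ_i(\cdot|B^{i-1},A_{i-L}^i)}{d\Pi_i^{\pi}(\cdot|B^{i-1})}(B_i)\Big\},$$ where, for every $\pi$ (with $J=L$), the joint law induced by $\pi$ is $$\mathbf P^\pi(da^i,db^i)=\nu(da^{-1},db^{-1})\otimes\bigotimes_{j=0}^i\big(\pi_j(da_j|a_{j-J}^{j-1},b^{j-1})\otimes Q_j(db_j|b^{j-1},a_{j-L}^j)\big),$$ and, for $i=0,\dots,n$ and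 almost all $b^{i-1}$, $$\Pi_i^\pi(db_i|b^{i-1})=\int Q_i(db_i|b^{i-1},a_{i-L}^i)\,\pi_i(da_i|a_{i-J}^{i-1},b^{i-1})\,\mathbf P^\pi(da_{i-J}^{i-1}|b^{i-1}).$$ Here the a posteriori distributions (the conditional distributions of $A_{i-J}^{i-1}$ given $B^{i-1}$) start from $\mathbf P^\pi(da_{-J}^{-1}|b^{-1})=\nu(da_{-J}^{-1}|b^{-1})$ and satisfy the following recursion for $i=1,\dots,n$. For given $b^{i-2}$ put $$T(db_{i-1},da_{i-J}^{i-1})=\int_{a_{i-1-J}}Q_{i-1}(db_{i-1}|b^{i-2},a_{i-1-L}^{i-1})\,\pi_{i-1}(da_{i-1}|a_{i-1-J}^{i-2},b^{i-2})\,\mathbf P^\pi(da_{i-1-J}^{i-2}|b^{i-2}).$$ Then for $\mathbf P^\pi$-almost all $b^{i-2}$ and $\Pi^\pi_{i-1}(\cdot|b^{i-2})$-almost all $b_{i-1}$ $$\mathbf P^\pi(da_{i-J}^{i-1}|b^{i-1})=\frac{T(db_{i-1},da_{i-J}^{i-1})}{\int T(db_{i-1},d\bar a_{i-J}^{i-1})},$$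 where the ratio denotes the disintegration of $T$ with respect to its marginal in $b_{i-1}$. (When $J=0$ the window $a_{i-J}^{i-1}$ is empty; symbols integrated out that are not in any window are absent.) **(b) With transmission cost.** Let $\gamma_i(a_{i-N}^i,b^i)\in[0,\infty)$, $i=0,\dots,n$, be measurable, let $\kappa\in[0,\infty)$, put $I=\max\{L,N\}$ and $$\mathcal P_{[0,n]}(\kappa)=\Big\{P\in\mathcal P_{[0,n]}:\ \tfrac1{n+1}\mathbf E^P\Big\{\sum_{i=0}^n\gamma_i(A_{i-N}^i,B^i)\Big\}\le\kappa\Big\}.$$ Suppose that the Lagrangian duality condition $$\sup_{P\in\mathcal P_{[0,n]}(\kappa)}I^P(A^n\to B^n)=\inf_{\lambda\ge0}\ \sup_{P\in\mathcal P_{[0,n]}}\Big\{I^P(A^n\to B^n)-\lambda\Big(\mathbf E^P\Big\{\sum_{i=0}^n\gamma_i(A_{i-N}^i,B^i)\Big\}-\kappa(n+1)\Big)\Big\}$$ holds (in the extended reals, with $0\cdot\infty=0$, $\infty-\infty=-\infty$ and $\sup\emptyset=-\infty$). Then the maximization of $I^P(A^n\to B^n)$ over $\mathcal P_{[0,n]}(\kappa)$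 occurs, in the same sense as in (a), in $\overline{\mathcal P}^{I}\cap\mathcal P_{[0,n]}(\kappa)$, and $$\sup_{P\in\mathcal P_{[0,n]}(\kappa)}I^P(A^n\to B^n)=\sup_{\substack{\{\pi_i(da_i|a_{i-I}^{i-1},b^{i-1})\}_{i=0}^n:\\ \frac1{n+1}\mathbf E^{\pi}\{\sum_{i}\gamma_i(A_{i-N}^i,B^i)\}\le\kappa}}\ \sum_{i=0}^n\mathbf E^{\pi}\Big\{\log\frac{dQ_i(\cdot|B^{i-1},A_{i-L}^i)}{d\Pi_i^{\pi}(\cdot|B^{i-1})}(B_i)\Big\}$$ (in this last equality suprema are taken in $[0,\infty]$), where for every such $\pi$ the joint laws, the output distributions $\Pi_i^\pi$ and the a posteriori distributions satisfy the formulas of (a) with $J=I$. -/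

import Mathlib

open MeasureTheory ProbabilityTheory Set
open scoped ENNReal NNReal

noncomputable section

/-- The space of symbols `(x_j)_{j ∈ S}` of a sequence of alphabets `X j`, `j ∈ ℤ`, at the times
in `S`. Thus `x^i`, `x^{i-1}`, `x_{i-m}^{i-1}`, `x_{i-m}^i` are points of `Seg X S` for
`S = Iic i, Iio i, Ico (i - m) i, Icc (i - m) i`. The past is two-sided infinite: the negative
times carry the initial data. -/
abbrev Seg (X : ℤ → Type*) (S : Set ℤ) : Type _ := (j : S) → X j

namespace Seg

variable {X : ℤ → Type*}

/-- Forget the symbols at times outside `U`. -/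
def restr {S U : Set ℤ} (h : U ⊆ S) (x : Seg X S) : Seg X U := fun j => x ⟨j.1, h j.2⟩

/-- Put the symbol `a` at time `t` next to the symbols `x` at times in `S`, and keep the times
in `U`. -/
def extend {S U : Set ℤ} (t : ℤ) (h : U ⊆ insert t S) (x : Seg X S) (a : X t) : Seg X U :=
  fun j => if e : j.1 = t then e ▸ a else x ⟨j.1, (h j.2).resolve_left e⟩

variable [∀ j, MeasurableSpace (X j)]

theorem measurable_restr {S U : Set ℤ} (h : U ⊆ S) : Measurable (restr (X := X) h) :=
  measurable_pi_lambda _ fun _ => measurable_pi_apply _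

theorem measurable_extend {S U : Set ℤ} (t : ℤ) (h : U ⊆ insert t S) :
    Measurable fun z : Seg X S × X t => extend t h z.1 z.2 := by
  refine measurable_pi_lambda _ fun j => ?_
  obtain ⟨j, hj⟩ := j
  by_cases e : j = t
  · subst e
    simpa [extend] using measurable_snd
  · simp only [extend, e, dite_false]
    exact (measurable_pi_apply (⟨j, (h hj).resolve_left e⟩ : S)).comp measurable_fst

end Seg

theorem seg_Iic_sub (t : ℤ) : Iic t ⊆ insert t (Iio t) := by
  intro j hj
  simp only [mem_Iic, mem_insert_iff, mem_Iio] at *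
  omega

theorem seg_Iio_succ_sub (k : ℕ) : Iio (((k + 1 : ℕ)) : ℤ) ⊆ Iic (k : ℤ) := by
  intro j hj
  simp only [mem_Iic, mem_Iio] at *
  omega

theorem seg_Iio_succ_sub_insert (k : ℕ) :
    Iio (((k + 1 : ℕ)) : ℤ) ⊆ insert (k : ℤ) (Iio (k : ℤ)) := by
  intro j hj
  simp only [mem_insert_iff, mem_Iio] at *
  omega

theorem seg_Iio_sub_Iic (t : ℤ) : Iio t ⊆ Iic t := Iio_subset_Iic_self

theorem seg_Icc_sub_Iic (t : ℤ) (m : ℕ) : Icc (t - m) t ⊆ Iic t := Icc_subset_Iic_self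

theorem seg_Ico_sub_Iio (t : ℤ) (m : ℕ) : Ico (t - m) t ⊆ Iio t := Ico_subset_Iio_self

theorem seg_window_sub (K : Set ℤ) (t : ℤ) (m : ℕ) : K ∩ Ico (t - m) t ⊆ K ∩ Iio t :=
  inter_subset_inter_right _ Ico_subset_Iio_self

theorem seg_Icc_sub_insert {L J : ℕ} (h : L ≤ J) (t : ℤ) :
    Icc (t - L) t ⊆ insert t (Ico (t - J) t) := by
  intro j hj
  simp only [mem_Icc, mem_insert_iff, mem_Ico] at *
  omega

theorem seg_Ico_succ_sub_insert (J k : ℕ) :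
    Ico (((k + 1 : ℕ) : ℤ) - J) ((k + 1 : ℕ) : ℤ) ⊆ insert (k : ℤ) (Ico ((k : ℤ) - J) k) := by
  intro j hj
  simp only [mem_insert_iff, mem_Ico] at *
  omega

/-- Stochastic kernels on `Y` given `X`. -/
abbrev StochKernel (X Y : Type*) [MeasurableSpace X] [MeasurableSpace Y] : Type _ :=
  {κ : Kernel X Y // IsMarkovKernel κ}

instance {X Y : Type*} [MeasurableSpace X] [MeasurableSpace Y] (κ : StochKernel X Y) :
    IsMarkovKernel κ.1 := κ.2

section Distributions

variable (A B : ℤ → Type*) [∀ j, MeasurableSpace (A j)] [∀ j, MeasurableSpace (B j)]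

/-- General channels `{C_i(db_i | b^{i-1}, a^i) : i = 0, …, n}`. -/
abbrev Channel (n : ℕ) : Type _ :=
  (i : Fin (n + 1)) → StochKernel (Seg B (Iio ((i : ℕ) : ℤ)) × Seg A (Iic ((i : ℕ) : ℤ)))
    (B ((i : ℕ) : ℤ))

/-- Kernels `{Q_i(db_i | b^{i-1}, a_{i-L}^i) : i = 0, …, n}`. -/
abbrev ChannelA (L n : ℕ) : Type _ :=
  (i : Fin (n + 1)) →
    StochKernel (Seg B (Iio ((i : ℕ) : ℤ)) × Seg A (Icc (((i : ℕ) : ℤ) - L) ((i : ℕ) : ℤ)))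
      (B ((i : ℕ) : ℤ))

/-- Channel input distributions with feedback `{P_i(da_i | a^{i-1}, b^{i-1}) : i = 0, …, n}`,
where `K` is the set of times whose input symbols are available to the encoder; it fixes the
convention on the initial data. `K = univ` means that all of `(a^{-1}, b^{-1})` is available,
`K = Ici (-L)` that `(a_{-L}^{-1}, b^{-1})` is, and `K = Ici 0` that only `b^{-1}` is. -/
abbrev InputDist (K : Set ℤ) (n : ℕ) : Type _ :=
  (i : Fin (n + 1)) → StochKernel (Seg A (K ∩ Iio ((i : ℕ) : ℤ)) × Seg B (Iio ((i : ℕ) : ℤ)))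
    (A ((i : ℕ) : ℤ))

/-- Kernels `{π_i(da_i | a_{i-J}^{i-1}, b^{i-1}) : i = 0, …, n}`. -/
abbrev Policy (K : Set ℤ) (J n : ℕ) : Type _ :=
  (i : Fin (n + 1)) →
    StochKernel (Seg A (K ∩ Ico (((i : ℕ) : ℤ) - J) ((i : ℕ) : ℤ)) × Seg B (Iio ((i : ℕ) : ℤ)))
      (A ((i : ℕ) : ℤ))

end Distributions

section Laws

variable {A B : ℤ → Type*} [∀ j, MeasurableSpace (A j)] [∀ j, MeasurableSpace (B j)]
variable {K : Set ℤ} {L J N n : ℕ}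

/-- A class A kernel family as a channel. -/
def ChannelA.toChannel (Q : ChannelA A B L n) : Channel A B n := fun i =>
  ⟨(Q i).1.comap (fun z => (z.1, Seg.restr (seg_Icc_sub_Iic _ L) z.2))
    (measurable_fst.prodMk ((Seg.measurable_restr _).comp measurable_snd)), inferInstance⟩

/-- A policy of finite input memory as a channel input distribution. -/
def Policy.toInput (π : Policy A B K J n) : InputDist A B K n := fun i =>
  ⟨(π i).1.comap (fun z => (Seg.restr (seg_window_sub K _ J) z.1, z.2))
    (((Seg.measurable_restr _).comp measurable_fst).prodMk measurable_snd), inferInstance⟩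

/-- One step: the law of `(A^k, B^{k-1})` from the law `μ` of `(A^{k-1}, B^{k-1})`. -/
def inputStep (k : ℕ) (p : StochKernel (Seg A (K ∩ Iio (k : ℤ)) × Seg B (Iio (k : ℤ))) (A k))
    (μ : Measure (Seg A (Iio (k : ℤ)) × Seg B (Iio (k : ℤ)))) :
    Measure (Seg A (Iic (k : ℤ)) × Seg B (Iio (k : ℤ))) :=
  (μ ⊗ₘ p.1.comap (fun z => (Seg.restr inter_subset_right z.1, z.2))
      (((Seg.measurable_restr _).comp measurable_fst).prodMk measurable_snd)).map
    fun z => (Seg.extend (k : ℤ) (seg_Iic_sub k) z.1.1 z.2, z.1.2)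

/-- One step: the law of `(A^k, B^k)` from the law `μ` of `(A^k, B^{k-1})`. -/
def outputStep (k : ℕ) (c : StochKernel (Seg B (Iio (k : ℤ)) × Seg A (Iic (k : ℤ))) (B k))
    (μ : Measure (Seg A (Iic (k : ℤ)) × Seg B (Iio (k : ℤ)))) :
    Measure (Seg A (Iic (k : ℤ)) × Seg B (Iic (k : ℤ))) :=
  (μ ⊗ₘ c.1.comap Prod.swap measurable_swap).map
    fun z => (z.1.1, Seg.extend (k : ℤ) (seg_Iic_sub k) z.1.2 z.2)

/-- The law of `(A^{k-1}, B^{k-1})`, `k = 0, …, n + 1`, that is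
`ν(da^{-1}, db^{-1}) ⊗ ⨂_{j < k} (P_j(da_j | a^{j-1}, b^{j-1}) ⊗ C_j(db_j | b^{j-1}, a^j))`. -/
def pastLaw (ν : Measure (Seg A (Iio ((0 : ℕ) : ℤ)) × Seg B (Iio ((0 : ℕ) : ℤ))))
    (C : Channel A B n) (P : InputDist A B K n) :
    (k : ℕ) → k ≤ n + 1 → Measure (Seg A (Iio (k : ℤ)) × Seg B (Iio (k : ℤ)))
  | 0, _ => ν
  | k + 1, h =>
    (outputStep k (C ⟨k, h⟩) (inputStep k (P ⟨k, h⟩) (pastLaw ν C P k (Nat.le_of_succ_le h)))).map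
      fun z => (Seg.restr (seg_Iio_succ_sub k) z.1, Seg.restr (seg_Iio_succ_sub k) z.2)

variable (ν : Measure (Seg A (Iio ((0 : ℕ) : ℤ)) × Seg B (Iio ((0 : ℕ) : ℤ))))
variable (C : Channel A B n) (P : InputDist A B K n)

/-- The law of `(A^i, B^{i-1})`. -/
def inputLaw (i : Fin (n + 1)) :
    Measure (Seg A (Iic ((i : ℕ) : ℤ)) × Seg B (Iio ((i : ℕ) : ℤ))) :=
  inputStep i (P i) (pastLaw ν C P i i.2.le)

/-- The law of `(A^i, B^i)`. -/
def jointLaw (i : Fin (n + 1)) :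
    Measure (Seg A (Iic ((i : ℕ) : ℤ)) × Seg B (Iic ((i : ℕ) : ℤ))) :=
  outputStep i (C i) (inputLaw ν C P i)

theorem isProbabilityMeasure_inputStep (k : ℕ)
    (p : StochKernel (Seg A (K ∩ Iio (k : ℤ)) × Seg B (Iio (k : ℤ))) (A k))
    (μ : Measure (Seg A (Iio (k : ℤ)) × Seg B (Iio (k : ℤ)))) [IsProbabilityMeasure μ] :
    IsProbabilityMeasure (inputStep k p μ) := by
  refine Measure.isProbabilityMeasure_map (Measurable.aemeasurable ?_)
  exact ((Seg.measurable_extend _ (seg_Iic_sub k)).comp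
    ((measurable_fst.comp measurable_fst).prodMk measurable_snd)).prodMk
    (measurable_snd.comp measurable_fst)

theorem isProbabilityMeasure_outputStep (k : ℕ)
    (c : StochKernel (Seg B (Iio (k : ℤ)) × Seg A (Iic (k : ℤ))) (B k))
    (μ : Measure (Seg A (Iic (k : ℤ)) × Seg B (Iio (k : ℤ)))) [IsProbabilityMeasure μ] :
    IsProbabilityMeasure (outputStep k c μ) := by
  refine Measure.isProbabilityMeasure_map (Measurable.aemeasurable ?_)
  exact (measurable_fst.comp measurable_fst).prodMk ((Seg.measurable_extend _ (seg_Iic_sub k)).comp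
    ((measurable_snd.comp measurable_fst).prodMk measurable_snd))

/-- The channel `C` is of class A with kernels `Q`: `C_i(· | b^{i-1}, a^i) = Q_i(· | b^{i-1}, a_{i-L}^i)`
for almost all `(b^{i-1}, a^i)` under every channel input distribution. -/
def IsClassA (K : Set ℤ) (Q : ChannelA A B L n) : Prop :=
  ∀ P : InputDist A B K n, ∀ i : Fin (n + 1), ∀ᵐ z ∂(inputLaw ν C P i),
    (C i).1 (z.2, z.1) = (Q i).1 (z.2, Seg.restr (seg_Icc_sub_Iic _ L) z.1)

/-- The channel input distributions of finite input memory `J`: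
`P_i(da_i | a^{i-1}, b^{i-1}) = π_i(da_i | a_{i-J}^{i-1}, b^{i-1})` for almost all
`(a^{i-1}, b^{i-1})`, `i = 0, …, n`. -/
def finiteMemoryInputs (K : Set ℤ) (J : ℕ) : Set (InputDist A B K n) :=
  {P | ∃ π : Policy A B K J n, ∀ i : Fin (n + 1), ∀ᵐ z ∂(pastLaw ν C P i i.2.le),
    (P i).1 (Seg.restr inter_subset_right z.1, z.2) =
      (π i).1 (Seg.restr (inter_subset_right.trans (seg_Ico_sub_Iio _ J)) z.1, z.2)}

/-- Transmission costs `γ_i(a_{i-N}^i, b^i) ∈ [0, ∞)`, `i = 0, …, n`. -/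
abbrev CostA (A B : ℤ → Type*) (N n : ℕ) : Type _ :=
  (i : Fin (n + 1)) →
    Seg A (Icc (((i : ℕ) : ℤ) - N) ((i : ℕ) : ℤ)) × Seg B (Iic ((i : ℕ) : ℤ)) → ℝ≥0

/-- `E^P ∑_i γ_i(A_{i-N}^i, B^i)`. -/
def totalCost (γ : CostA A B N n) : ℝ≥0∞ :=
  ∑ i : Fin (n + 1), ∫⁻ z, (γ i (Seg.restr (seg_Icc_sub_Iic _ N) z.1, z.2) : ℝ≥0∞)
    ∂(jointLaw ν C P i)

/-- The channel input distributions with `(1 / (n + 1)) E^P ∑_i γ_i(A_{i-N}^i, B^i) ≤ κ`. -/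
def costConstrained (K : Set ℤ) (γ : CostA A B N n) (κ : ℝ≥0) : Set (InputDist A B K n) :=
  {P | totalCost ν C P γ / (n + 1) ≤ κ}

/-- The measure `T(db_k, da_{k+1-J}^k)
= ∫ Q_k(db_k | s, a_{k-L}^k) ⊗ π_k(da_k | a_{k-J}^{k-1}, s) ⊗ ξ(da_{k-J}^{k-1})`,
with the integral over the symbol `a_{k-J}`; here `s = b^{k-1}` and `ξ` is a distribution of
`a_{k-J}^{k-1}`. -/
def bayesNumerator (hLJ : L ≤ J) (k : ℕ)
    (q : StochKernel (Seg B (Iio (k : ℤ)) × Seg A (Icc ((k : ℤ) - L) k)) (B k))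
    (p : StochKernel (Seg A (K ∩ Ico ((k : ℤ) - J) k) × Seg B (Iio (k : ℤ))) (A k))
    (s : Seg B (Iio (k : ℤ))) (ξ : Measure (Seg A (Ico ((k : ℤ) - J) k))) :
    Measure (B k × Seg A (Ico (((k + 1 : ℕ) : ℤ) - J) ((k + 1 : ℕ) : ℤ))) :=
  ((ξ ⊗ₘ p.1.comap (fun w => (Seg.restr inter_subset_right w, s))
        ((Seg.measurable_restr _).prodMk measurable_const)) ⊗ₘ
      q.1.comap (fun z => (s, Seg.extend (k : ℤ) (seg_Icc_sub_insert hLJ k) z.1 z.2))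
        (measurable_const.prodMk (Seg.measurable_extend _ _))).map
    fun z => (z.2, Seg.extend (k : ℤ) (seg_Ico_succ_sub_insert J k) z.1.1 z.1.2)

instance isFiniteMeasure_bayesNumerator (hLJ : L ≤ J) (k : ℕ)
    (q : StochKernel (Seg B (Iio (k : ℤ)) × Seg A (Icc ((k : ℤ) - L) k)) (B k))
    (p : StochKernel (Seg A (K ∩ Ico ((k : ℤ) - J) k) × Seg B (Iio (k : ℤ))) (A k))
    (s : Seg B (Iio (k : ℤ))) (ξ : Measure (Seg A (Ico ((k : ℤ) - J) k)))
    [IsFiniteMeasure ξ] : IsFiniteMeasure (bayesNumerator hLJ k q p s ξ) := by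
  unfold bayesNumerator
  infer_instance

variable [IsProbabilityMeasure ν]

instance isProbabilityMeasure_pastLaw (k : ℕ) (hk : k ≤ n + 1) :
    IsProbabilityMeasure (pastLaw ν C P k hk) := by
  induction k with
  | zero => simpa only [pastLaw]
  | succ k ih =>
    have := ih (Nat.le_of_succ_le hk)
    have := isProbabilityMeasure_inputStep k (P ⟨k, hk⟩)
      (pastLaw ν C P k (Nat.le_of_succ_le hk))
    have := isProbabilityMeasure_outputStep k (C ⟨k, hk⟩)
      (inputStep k (P ⟨k, hk⟩) (pastLaw ν C P k (Nat.le_of_succ_le hk)))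
    rw [pastLaw]
    exact Measure.isProbabilityMeasure_map (Measurable.aemeasurable
      (((Seg.measurable_restr _).comp measurable_fst).prodMk
        ((Seg.measurable_restr _).comp measurable_snd)))

instance isProbabilityMeasure_inputLaw (i : Fin (n + 1)) :
    IsProbabilityMeasure (inputLaw ν C P i) :=
  isProbabilityMeasure_inputStep _ _ _

instance isProbabilityMeasure_jointLaw (i : Fin (n + 1)) :
    IsProbabilityMeasure (jointLaw ν C P i) :=
  isProbabilityMeasure_outputStep _ _ _

/-- The law of `B^{k-1}`. -/
def outputPastLaw (k : ℕ) (hk : k ≤ n + 1) : Measure (Seg B (Iio (k : ℤ))) :=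
  (pastLaw ν C P k hk).map Prod.snd

section Conditional

variable [∀ j, StandardBorelSpace (A j)] [∀ j, Nonempty (A j)]
variable [∀ j, StandardBorelSpace (B j)] [∀ j, Nonempty (B j)]

/-- `Π_i^P(db_i | b^{i-1})`, the conditional distribution of `B_i` given `B^{i-1}`. -/
def outputDist (i : Fin (n + 1)) : Kernel (Seg B (Iio ((i : ℕ) : ℤ))) (B ((i : ℕ) : ℤ)) :=
  condDistrib (fun z => z.2 ⟨((i : ℕ) : ℤ), le_refl ((i : ℕ) : ℤ)⟩)
    (fun z => Seg.restr (seg_Iio_sub_Iic _) z.2) (jointLaw ν C P i)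

/-- The a posteriori distribution `P(da_{k-J}^{k-1} | b^{k-1})`. -/
def posteriorDist (J k : ℕ) (hk : k ≤ n + 1) :
    Kernel (Seg B (Iio (k : ℤ))) (Seg A (Ico ((k : ℤ) - J) k)) :=
  condDistrib (fun z => Seg.restr (seg_Ico_sub_Iio _ J) z.1) (fun z => z.2) (pastLaw ν C P k hk)

/-- Directed information
`I(A^n → B^n) = ∑_i E ∫ log (dC_i(· | B^{i-1}, A^i) / dΠ_i^P(· | B^{i-1})) dC_i(· | B^{i-1}, A^i)`
in `[0, ∞]`; the inner integral is a relative entropy, which is `∞` where the density does not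
exist. -/
def directedInfo : ℝ≥0∞ :=
  ∑ i : Fin (n + 1), ∫⁻ z, InformationTheory.klDiv ((C i).1 (z.2, z.1))
    (outputDist ν C P i z.2) ∂(inputLaw ν C P i)

/-- The Lagrangian duality condition
`sup_{P : cost ≤ κ} I(A^n → B^n) = inf_{λ ≥ 0} sup_P {I(A^n → B^n) - λ (E^P ∑_i γ_i - κ (n + 1))}`,
in the extended reals with `λ ∞ = ∞` for `λ > 0`, `0 ∞ = 0` and `∞ - ∞ = -∞`. -/
def LagrangianDuality (K : Set ℤ) (γ : CostA A B N n) (κ : ℝ≥0) : Prop :=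
  (⨆ P ∈ costConstrained ν C K γ κ, (directedInfo ν C P : EReal)) =
    ⨅ l : ℝ≥0, ⨆ P : InputDist A B K n,
      (directedInfo ν C P : EReal) -
        ((l : ℝ) : EReal) *
          ((totalCost ν C P γ : EReal) - ((κ : ℝ) : EReal) * (((n : ℝ) + 1 : ℝ) : EReal))

/-- The normalized measure `T(db_k, ·) / T(db_k, univ)`: the disintegration at `b` of the measure
`T` with respect to its marginal on the output symbol `b_k`. -/
def bayesUpdate (hLJ : L ≤ J) (k : ℕ)
    (q : StochKernel (Seg B (Iio (k : ℤ)) × Seg A (Icc ((k : ℤ) - L) k)) (B k))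
    (p : StochKernel (Seg A (K ∩ Ico ((k : ℤ) - J) k) × Seg B (Iio (k : ℤ))) (A k))
    (s : Seg B (Iio (k : ℤ))) (ξ : Measure (Seg A (Ico ((k : ℤ) - J) k)))
    [IsFiniteMeasure ξ] (b : B k) :
    Measure (Seg A (Ico (((k + 1 : ℕ) : ℤ) - J) ((k + 1 : ℕ) : ℤ))) :=
  (bayesNumerator hLJ k q p s ξ).condKernel b

instance isMarkovKernel_posteriorDist (J k : ℕ) (hk : k ≤ n + 1) :
    IsMarkovKernel (posteriorDist ν C P J k hk) := by
  unfold posteriorDist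
  infer_instance

/-- For the class A channel `Q` and the policy `π`, the output distributions satisfy
`Π_i^π(· | b^{i-1}) = ∫ Q_i(· | b^{i-1}, a_{i-L}^i) π_i(da_i | a_{i-J}^{i-1}, b^{i-1})
P^π(da_{i-J}^{i-1} | b^{i-1})` for almost all `b^{i-1}`, `i = 0, …, n`. -/
def OutputFormula (hLJ : L ≤ J) (Q : ChannelA A B L n) (π : Policy A B K J n) : Prop :=
  ∀ i : Fin (n + 1), ∀ᵐ s ∂(outputPastLaw ν Q.toChannel π.toInput i i.2.le),
    ∀ E : Set (B ((i : ℕ) : ℤ)), MeasurableSet E →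
      outputDist ν Q.toChannel π.toInput i s E =
        ∫⁻ w, ∫⁻ a, (Q i).1 (s, Seg.extend _ (seg_Icc_sub_insert hLJ _) w a) E
          ∂((π i).1 (Seg.restr inter_subset_right w, s))
          ∂(posteriorDist ν Q.toChannel π.toInput J i i.2.le s)

/-- For the class A channel `Q` and the policy `π`, the a posteriori distributions start from the
conditional distribution of `A_{-J}^{-1}` given `B^{-1}` under `ν` and satisfy, with
`k + 1 = 1, …, n` and for almost all `b^k = (s, b)`, the recursion
`P^π(· | b^k) = T̃_k(b_k, b^{k-1}, π_k, P^π(· | b^{k-1}))`. -/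
def PosteriorRecursion (hLJ : L ≤ J) (Q : ChannelA A B L n) (π : Policy A B K J n) : Prop :=
  (∀ᵐ s ∂(ν.map Prod.snd), posteriorDist ν Q.toChannel π.toInput J 0 (Nat.zero_le _) s =
    condDistrib (fun z => Seg.restr (seg_Ico_sub_Iio _ J) z.1) (fun z => z.2) ν s) ∧
  ∀ (k : ℕ) (hk : k + 1 ≤ n),
    ∀ᵐ s ∂(outputPastLaw ν Q.toChannel π.toInput k (by omega)),
      ∀ᵐ b ∂(outputDist ν Q.toChannel π.toInput ⟨k, by omega⟩ s),
        posteriorDist ν Q.toChannel π.toInput J (k + 1) (by omega)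
            (Seg.extend (k : ℤ) (seg_Iio_succ_sub_insert k) s b) =
          bayesUpdate hLJ k (Q ⟨k, by omega⟩) (π ⟨k, by omega⟩) s
            (posteriorDist ν Q.toChannel π.toInput J k (by omega) s) b

end Conditional

end Laws

end

/-!
The class A condition makes all joint laws under `C` those under `Q` (`IsClassA.jointLaw_eq`), so
`C` may be replaced by `Q` throughout.

Fix `J ≥ L` and an input distribution `P`. At time `i`, replace `P_i` by the conditional
distribution `π_i` of `A_i` given the part of `(A_{i-J}^{i-1}, B^{i-1})` known to the encoder.
The law of the window `(A_{i-J}^i, B^i)` does not change: by induction the law of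
`(A_{i-J}^{i-1}, B^{i-1})` is the same for `P` and for `π`, the law of `(A_{i-J}^i, B^{i-1})` is
this law extended by `π_i`, and since `L ≤ J` the kernel `Q_i` reads only the window
(`pastWindow_pastLaw_eq`). The known times form an upper set `K`; if the window contains times
outside `K`, then all known past inputs lie in the window, and `π_i = P_i` is taken instead
(`exists_windowCompatible`).

The relative entropy of `Q_i(· | b^{i-1}, a_{i-L}^i)` with respect to `Π_i(· | b^{i-1})` is a
measurable function of the window, and `Π_i` depends only on the law of `B^i`, so `P` and `π`
have the same directed information (`directedInfo_eq_of_isWindowPolicy`). If moreover `N ≤ J`,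
they have the same cost (`totalCost_eq_of_isWindowPolicy`). Hence every value of information and
cost attained by some `P` is attained by a policy of memory `J`, with `J = L` without cost and
`J = max L N` with cost. Information and cost are preserved separately, so the replacement
respects the cost constraint.

For a policy, disintegrating the law of `(B^{i-1}, (B_i, A_{i+1-J}^i))` along `B^{i-1}` gives
the Bayes numerator `T` (`jointLaw_map_eq_compProd_bayesKernel`). Its marginal in `b_i` is
`Π_i`, which is the formula for the output distributions; disintegrating it further along `b_i`
gives the a posteriori distribution of the next window, which is the recursion. Both follow from
almost sure uniqueness of disintegrations.
-/

noncomputable section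

/-! ### Restriction and extension of segments -/

namespace Seg

variable {X : ℤ → Type*} {Ω : Type*} [MeasurableSpace Ω]

theorem extend_self {S U : Set ℤ} (t : ℤ) (h : U ⊆ insert t S) (x : Seg X S) (a : X t)
    (ht : t ∈ U) : extend t h x a ⟨t, ht⟩ = a := by
  simp [extend]

theorem restr_extend {S S' U V : Set ℤ} (t : ℤ) (hU : U ⊆ insert t S) (hV : V ⊆ U)
    (hS : S' ⊆ S) (hV' : V ⊆ insert t S') (x : Seg X S) (a : X t) :
    restr hV (extend t hU x a) = extend t hV' (restr hS x) a := by
  funext j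
  by_cases e : j.1 = t <;> simp [restr, extend, e]

theorem restr_extend_of_notMem {S U V : Set ℤ} (t : ℤ) (hU : U ⊆ insert t S) (hV : V ⊆ U)
    (hS : V ⊆ S) (ht : t ∉ V) (x : Seg X S) (a : X t) :
    restr hV (extend t hU x a) = restr hS x := by
  funext j
  have e : j.1 ≠ t := fun e => ht (e ▸ j.2)
  simp [restr, extend, e]

theorem extend_restr {S S' U : Set ℤ} (t : ℤ) (hU : U ⊆ insert t S') (hS : S' ⊆ S) (hUS : U ⊆ S)
    (ht : t ∈ S) (x : Seg X S) :
    extend t hU (restr hS x) (x ⟨t, ht⟩) = restr hUS x := by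
  funext ⟨j, hj⟩
  by_cases e : j = t
  · subst e; simp [restr, extend]
  · simp [restr, extend, e]

variable [∀ j, MeasurableSpace (X j)]

@[fun_prop]
theorem _root_.Measurable.seg_restr {S U : Set ℤ} {h : U ⊆ S} {f : Ω → Seg X S}
    (hf : Measurable f) : Measurable fun z => restr h (f z) :=
  (measurable_restr h).comp hf

@[fun_prop]
theorem _root_.Measurable.seg_extend {S U : Set ℤ} {t : ℤ} {h : U ⊆ insert t S} {f : Ω → Seg X S}
    {g : Ω → X t} (hf : Measurable f) (hg : Measurable g) :
    Measurable fun z => extend t h (f z) (g z) :=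
  (measurable_extend t h).comp (hf.prodMk hg)

end Seg

/-! ### Kernels and relative entropy -/

section Kernels

variable {α β γ : Type*} [MeasurableSpace α] [MeasurableSpace β] [MeasurableSpace γ]

/-- If a kernel sees the state only through `f`, then the joint law with the state replaced by its
image under `f` is obtained from the image law. -/
theorem map_compProd_comap (μ : Measure α) [SFinite μ] (κ : Kernel β γ) [IsSFiniteKernel κ]
    {f : α → β} (hf : Measurable f) :
    (μ ⊗ₘ κ.comap f hf).map (fun z => (f z.1, z.2)) = μ.map f ⊗ₘ κ := by
  ext s hs
  rw [Measure.map_apply (by fun_prop) hs, Measure.compProd_apply (hs.preimage (by fun_prop)),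
    Measure.compProd_apply hs, lintegral_map (Kernel.measurable_kernel_prodMk_left hs) hf]
  rfl

/-- Relative entropy of kernels is measurable in the parameter: the kernel version of the
Radon–Nikodym derivative is jointly measurable. -/
theorem measurable_klDiv_kernel [MeasurableSpace.CountableOrCountablyGenerated α γ]
    (κ η : Kernel α γ) [IsFiniteKernel κ] [IsFiniteKernel η] :
    Measurable fun a => InformationTheory.klDiv (κ a) (η a) := by
  classical
  have h : (fun a => InformationTheory.klDiv (κ a) (η a)) = fun a => if κ a ≪ η a then
      ∫⁻ x, ENNReal.ofReal (InformationTheory.klFun (κ.rnDeriv η a x).toReal) ∂(η a) else ∞ := by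
    funext a
    rw [InformationTheory.klDiv_eq_lintegral_klFun]
    split_ifs
    · refine lintegral_congr_ae ?_
      filter_upwards [Kernel.rnDeriv_eq_rnDeriv_measure (κ := κ) (η := η) (a := a)] with x hx
      rw [hx]
    · rfl
  rw [h]
  refine Measurable.ite (Kernel.measurableSet_absolutelyContinuous κ η) ?_ measurable_const
  refine Measurable.lintegral_kernel_prod_right
    (f := fun a x => ENNReal.ofReal (InformationTheory.klFun (κ.rnDeriv η a x).toReal)) ?_
  exact (InformationTheory.measurable_klFun.comp
    (Kernel.measurable_rnDeriv κ η).ennreal_toReal).ennreal_ofReal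

end Kernels

/-! ### Laws of windows -/

section Windows

variable {A B : ℤ → Type*} [∀ j, MeasurableSpace (A j)] [∀ j, MeasurableSpace (B j)]
variable {K : Set ℤ} {L J N n : ℕ}

theorem Icc_sub_insert_Ico (t : ℤ) (J : ℕ) : Icc (t - J) t ⊆ insert t (Ico (t - J) t) :=
  seg_Icc_sub_insert le_rfl t

theorem Icc_sub_Icc {L J : ℕ} (h : L ≤ J) (t : ℤ) : Icc (t - L) t ⊆ Icc (t - J) t :=
  Icc_subset_Icc_left (by omega)

theorem Ico_succ_sub_Icc (J k : ℕ) :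
    Ico (((k + 1 : ℕ) : ℤ) - J) ((k + 1 : ℕ) : ℤ) ⊆ Icc ((k : ℤ) - J) k := by
  intro j hj
  simp only [mem_Icc, mem_Ico] at *
  omega

/-- The input kernel `p` as a kernel given all of `(a^{k-1}, b^{k-1})`, of which it reads the input
symbols at times in `K`. -/
def knownInput (k : ℕ) (p : StochKernel (Seg A (K ∩ Iio (k : ℤ)) × Seg B (Iio (k : ℤ))) (A k)) :
    Kernel (Seg A (Iio (k : ℤ)) × Seg B (Iio (k : ℤ))) (A k) :=
  p.1.comap (fun z => (Seg.restr inter_subset_right z.1, z.2)) (by fun_prop)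

instance (k : ℕ) (p : StochKernel (Seg A (K ∩ Iio (k : ℤ)) × Seg B (Iio (k : ℤ))) (A k)) :
    IsMarkovKernel (knownInput k p) := by unfold knownInput; infer_instance

/-- A kernel `p` of memory `J` as a kernel given the whole window `(a_{k-J}^{k-1}, b^{k-1})`, of which
it reads the input symbols at times in `K`. -/
def windowInput (k : ℕ)
    (p : StochKernel (Seg A (K ∩ Ico ((k : ℤ) - J) k) × Seg B (Iio (k : ℤ))) (A k)) :
    Kernel (Seg A (Ico ((k : ℤ) - J) k) × Seg B (Iio (k : ℤ))) (A k) :=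
  p.1.comap (fun z => (Seg.restr inter_subset_right z.1, z.2)) (by fun_prop)

instance (k : ℕ) (p : StochKernel (Seg A (K ∩ Ico ((k : ℤ) - J) k) × Seg B (Iio (k : ℤ))) (A k)) :
    IsMarkovKernel (windowInput k p) := by unfold windowInput; infer_instance

/-- The law of `(A_{k-J}^{k-1}, B^{k-1})` when `μ` is the law of `(A^{k-1}, B^{k-1})`. -/
def pastWindow (J k : ℕ) (μ : Measure (Seg A (Iio (k : ℤ)) × Seg B (Iio (k : ℤ)))) :
    Measure (Seg A (Ico ((k : ℤ) - J) k) × Seg B (Iio (k : ℤ))) :=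
  μ.map fun z => (Seg.restr (seg_Ico_sub_Iio _ J) z.1, z.2)

instance (J k : ℕ) (μ : Measure (Seg A (Iio (k : ℤ)) × Seg B (Iio (k : ℤ))))
    [IsProbabilityMeasure μ] : IsProbabilityMeasure (pastWindow J k μ) :=
  Measure.isProbabilityMeasure_map (Measurable.aemeasurable (by fun_prop))

/-- If `(A^{k-1}, B^{k-1})` has law `μ` and `A_k` is drawn by `p`, then `q` is a conditional distribution
of `A_k` given `(A_{k-J}^{k-1}, B^{k-1})`. The conditioning is on the whole window, although `q` reads
only its part known to the encoder. -/
def WindowCompatible (k : ℕ) (μ : Measure (Seg A (Iio (k : ℤ)) × Seg B (Iio (k : ℤ))))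
    (p : StochKernel (Seg A (K ∩ Iio (k : ℤ)) × Seg B (Iio (k : ℤ))) (A k))
    (q : StochKernel (Seg A (K ∩ Ico ((k : ℤ) - J) k) × Seg B (Iio (k : ℤ))) (A k)) : Prop :=
  (μ ⊗ₘ knownInput k p).map (fun z => ((Seg.restr (seg_Ico_sub_Iio _ J) z.1.1, z.1.2), z.2)) =
    pastWindow J k μ ⊗ₘ windowInput k q

theorem windowCompatible_toInput (π : Policy A B K J n) (i : Fin (n + 1))
    (μ : Measure (Seg A (Iio ((i : ℕ) : ℤ)) × Seg B (Iio ((i : ℕ) : ℤ)))) [SFinite μ] :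
    WindowCompatible i μ (π.toInput i) (π i) :=
  map_compProd_comap μ (windowInput (i : ℕ) (π i))
    (f := fun z => (Seg.restr (seg_Ico_sub_Iio _ J) z.1, z.2)) (by fun_prop)

/-- Conditioning on the whole window needs only its part known to the encoder. This uses that the
known times form an upper set: either the window lies in `K`, or `K` has no times before it. -/
theorem exists_windowCompatible [∀ j, StandardBorelSpace (A j)] [∀ j, Nonempty (A j)]
    (hK : IsUpperSet K) (J k : ℕ) (μ : Measure (Seg A (Iio (k : ℤ)) × Seg B (Iio (k : ℤ))))
    [IsProbabilityMeasure μ]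
    (p : StochKernel (Seg A (K ∩ Iio (k : ℤ)) × Seg B (Iio (k : ℤ))) (A k)) :
    ∃ q : StochKernel (Seg A (K ∩ Ico ((k : ℤ) - J) k) × Seg B (Iio (k : ℤ))) (A k),
      WindowCompatible k μ p q := by
  by_cases h : Ico ((k : ℤ) - J) k ⊆ K
  -- the whole window is known: disintegrate the law of the window and the next symbol
  · set ρ := (μ ⊗ₘ knownInput k p).map
      (fun z => ((Seg.restr (seg_Ico_sub_Iio _ J) z.1.1, z.1.2), z.2)) with hρ
    have hfst : ρ.fst = pastWindow J k μ := by
      rw [hρ, Measure.fst, Measure.map_map (by fun_prop) (by fun_prop), pastWindow]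
      conv_rhs => rw [← Measure.fst_compProd μ (knownInput k p)]
      rw [Measure.fst, Measure.map_map (by fun_prop) (by fun_prop)]
      rfl
    refine ⟨⟨ρ.condKernel.comap (fun z => (Seg.restr (subset_inter h subset_rfl) z.1, z.2))
      (by fun_prop), inferInstance⟩, ?_⟩
    rw [WindowCompatible, ← hfst, ← hρ]
    exact (ρ.disintegrate ρ.condKernel).symm
  -- the window reaches beyond the known times: every known past symbol lies in it
  · have hsub : K ∩ Iio (k : ℤ) ⊆ K ∩ Ico ((k : ℤ) - J) k := by
      obtain ⟨j, hj, hjK⟩ := not_subset.1 h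
      rintro m ⟨hm, hmk⟩
      refine ⟨hm, ?_, hmk⟩
      by_contra hlt
      exact hjK (hK ((not_le.1 hlt).le.trans hj.1) hm)
    refine ⟨⟨p.1.comap (fun z => (Seg.restr hsub z.1, z.2)) (by fun_prop), inferInstance⟩, ?_⟩
    exact map_compProd_comap μ (windowInput k ⟨p.1.comap (fun z => (Seg.restr hsub z.1, z.2))
      (by fun_prop), inferInstance⟩)
      (f := fun z => (Seg.restr (seg_Ico_sub_Iio _ J) z.1, z.2)) (by fun_prop)

theorem inputStep_map_window (k : ℕ) (μ : Measure (Seg A (Iio (k : ℤ)) × Seg B (Iio (k : ℤ))))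
    (p : StochKernel (Seg A (K ∩ Iio (k : ℤ)) × Seg B (Iio (k : ℤ))) (A k))
    (q : StochKernel (Seg A (K ∩ Ico ((k : ℤ) - J) k) × Seg B (Iio (k : ℤ))) (A k))
    (h : WindowCompatible k μ p q) :
    (inputStep k p μ).map (fun z => (Seg.restr (seg_Icc_sub_Iic _ J) z.1, z.2)) =
      (pastWindow J k μ ⊗ₘ windowInput k q).map
        fun z => (Seg.extend (k : ℤ) (Icc_sub_insert_Ico _ J) z.1.1 z.2, z.1.2) := by
  rw [← h, inputStep, Measure.map_map (by fun_prop) (by fun_prop),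
    Measure.map_map (by fun_prop) (by fun_prop)]
  refine congrArg₂ Measure.map ?_ rfl
  funext z
  simp only [Function.comp_apply]
  rw [Seg.restr_extend _ _ _ (seg_Ico_sub_Iio _ J)]

theorem outputStep_map_window (hLJ : L ≤ J) (k : ℕ)
    (μ : Measure (Seg A (Iic (k : ℤ)) × Seg B (Iio (k : ℤ)))) [SFinite μ]
    (Q : ChannelA A B L n) (hk : k < n + 1) :
    (outputStep k (Q.toChannel ⟨k, hk⟩) μ).map
        (fun z => (Seg.restr (seg_Icc_sub_Iic _ J) z.1, z.2)) =
      ((μ.map fun z => (Seg.restr (seg_Icc_sub_Iic _ J) z.1, z.2)) ⊗ₘ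
        (Q ⟨k, hk⟩).1.comap (fun z => (z.2, Seg.restr (Icc_sub_Icc hLJ (k : ℤ)) z.1))
          (by fun_prop)).map
        fun z => (z.1.1, Seg.extend (k : ℤ) (seg_Iic_sub k) z.1.2 z.2) := by
  rw [← map_compProd_comap μ _ (by fun_prop), outputStep,
    Measure.map_map (by fun_prop) (by fun_prop), Measure.map_map (by fun_prop) (by fun_prop)]
  rfl

end Windows

/-! ### Policies with the same window laws -/

section Agreement

variable {A B : ℤ → Type*} [∀ j, MeasurableSpace (A j)] [∀ j, MeasurableSpace (B j)]
variable {K : Set ℤ} {L J N n : ℕ}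
variable (ν : Measure (Seg A (Iio ((0 : ℕ) : ℤ)) × Seg B (Iio ((0 : ℕ) : ℤ))))

/-- At every time `i`, the kernel `π_i` is, under `P`, a conditional distribution of `A_i` given
`(A_{i-J}^{i-1}, B^{i-1})`. -/
def IsWindowPolicy (C : Channel A B n) (P : InputDist A B K n) (π : Policy A B K J n) : Prop :=
  ∀ i : Fin (n + 1), WindowCompatible i (pastLaw ν C P i i.2.le) (P i) (π i)

theorem pastWindow_pastLaw_succ (C : Channel A B n) (P : InputDist A B K n) (k : ℕ)
    (hk : k + 1 ≤ n + 1) :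
    pastWindow J (k + 1) (pastLaw ν C P (k + 1) hk) =
      ((jointLaw ν C P ⟨k, hk⟩).map fun z => (Seg.restr (seg_Icc_sub_Iic (k : ℤ) J) z.1, z.2)).map
        fun z => (Seg.restr (Ico_succ_sub_Icc J k) z.1, Seg.restr (seg_Iio_succ_sub k) z.2) := by
  rw [pastWindow, pastLaw, Measure.map_map (by fun_prop) (by fun_prop),
    Measure.map_map (by fun_prop) (by fun_prop)]
  rfl

theorem inputLaw_map_window (C : Channel A B n) (P : InputDist A B K n) (π : Policy A B K J n)
    (i : Fin (n + 1)) (h : WindowCompatible i (pastLaw ν C P i i.2.le) (P i) (π i)) :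
    (inputLaw ν C P i).map (fun z => (Seg.restr (seg_Icc_sub_Iic _ J) z.1, z.2)) =
      (pastWindow J i (pastLaw ν C P i i.2.le) ⊗ₘ windowInput (i : ℕ) (π i)).map
        fun z => (Seg.extend ((i : ℕ) : ℤ) (Icc_sub_insert_Ico _ J) z.1.1 z.2, z.1.2) :=
  inputStep_map_window _ _ _ _ h

variable [IsProbabilityMeasure ν]

theorem isWindowPolicy_toInput (C : Channel A B n) (π : Policy A B K J n) :
    IsWindowPolicy ν C π.toInput π :=
  fun i => windowCompatible_toInput π i _

theorem exists_isWindowPolicy [∀ j, StandardBorelSpace (A j)] [∀ j, Nonempty (A j)]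
    (hK : IsUpperSet K) (J : ℕ) (C : Channel A B n) (P : InputDist A B K n) :
    ∃ π : Policy A B K J n, IsWindowPolicy ν C P π := by
  choose π hπ using fun i : Fin (n + 1) =>
    exists_windowCompatible hK J i (pastLaw ν C P i i.2.le) (P i)
  exact ⟨π, hπ⟩

theorem jointLaw_map_window (hLJ : L ≤ J) (Q : ChannelA A B L n) (P : InputDist A B K n)
    (i : Fin (n + 1)) :
    (jointLaw ν Q.toChannel P i).map (fun z => (Seg.restr (seg_Icc_sub_Iic _ J) z.1, z.2)) =
      (((inputLaw ν Q.toChannel P i).map fun z => (Seg.restr (seg_Icc_sub_Iic _ J) z.1, z.2)) ⊗ₘ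
        (Q i).1.comap (fun z => (z.2, Seg.restr (Icc_sub_Icc hLJ ((i : ℕ) : ℤ)) z.1))
          (by fun_prop)).map
        fun z => (z.1.1, Seg.extend ((i : ℕ) : ℤ) (seg_Iic_sub _) z.1.2 z.2) :=
  outputStep_map_window hLJ _ _ Q i.2

variable {ν} {Q : ChannelA A B L n} {P P' : InputDist A B K n} {π : Policy A B K J n}

theorem pastWindow_pastLaw_eq (hLJ : L ≤ J)
    (h : IsWindowPolicy ν Q.toChannel P π)
    (h' : IsWindowPolicy ν Q.toChannel P' π)
    (k : ℕ) (hk : k ≤ n + 1) :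
    pastWindow J k (pastLaw ν Q.toChannel P k hk) =
      pastWindow J k (pastLaw ν Q.toChannel P' k hk) := by
  induction k with
  | zero => rfl
  | succ k ih =>
    rw [pastWindow_pastLaw_succ, pastWindow_pastLaw_succ, jointLaw_map_window ν hLJ,
      jointLaw_map_window ν hLJ, inputLaw_map_window ν _ _ _ _ (h ⟨k, hk⟩),
      inputLaw_map_window ν _ _ _ _ (h' ⟨k, hk⟩)]
    dsimp only
    rw [ih]

theorem inputLaw_map_window_eq (hLJ : L ≤ J)
    (h : IsWindowPolicy ν Q.toChannel P π)
    (h' : IsWindowPolicy ν Q.toChannel P' π)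
    (i : Fin (n + 1)) :
    (inputLaw ν Q.toChannel P i).map (fun z => (Seg.restr (seg_Icc_sub_Iic _ J) z.1, z.2)) =
      (inputLaw ν Q.toChannel P' i).map fun z => (Seg.restr (seg_Icc_sub_Iic _ J) z.1, z.2) := by
  rw [inputLaw_map_window ν _ _ _ _ (h i), inputLaw_map_window ν _ _ _ _ (h' i),
    pastWindow_pastLaw_eq hLJ h h']

theorem jointLaw_map_window_eq (hLJ : L ≤ J)
    (h : IsWindowPolicy ν Q.toChannel P π)
    (h' : IsWindowPolicy ν Q.toChannel P' π)
    (i : Fin (n + 1)) :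
    (jointLaw ν Q.toChannel P i).map (fun z => (Seg.restr (seg_Icc_sub_Iic _ J) z.1, z.2)) =
      (jointLaw ν Q.toChannel P' i).map fun z => (Seg.restr (seg_Icc_sub_Iic _ J) z.1, z.2) := by
  rw [jointLaw_map_window ν hLJ, jointLaw_map_window ν hLJ, inputLaw_map_window_eq hLJ h h']

theorem totalCost_eq_of_isWindowPolicy (hLJ : L ≤ J) (hNJ : N ≤ J)
    (h : IsWindowPolicy ν Q.toChannel P π)
    (h' : IsWindowPolicy ν Q.toChannel P' π)
    {γ : CostA A B N n} (hγ : ∀ i, Measurable (γ i)) :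
    totalCost ν Q.toChannel P γ = totalCost ν Q.toChannel P' γ := by
  have key : ∀ (P : InputDist A B K n) (i : Fin (n + 1)),
      ∫⁻ z, (γ i (Seg.restr (seg_Icc_sub_Iic _ N) z.1, z.2) : ℝ≥0∞)
          ∂(jointLaw ν Q.toChannel P i) =
        ∫⁻ z, (γ i (Seg.restr (Icc_sub_Icc hNJ ((i : ℕ) : ℤ)) z.1, z.2) : ℝ≥0∞)
          ∂((jointLaw ν Q.toChannel P i).map
            fun z => (Seg.restr (seg_Icc_sub_Iic _ J) z.1, z.2)) := fun P i => by
    have := hγ i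
    rw [lintegral_map (by fun_prop) (by fun_prop)]
    rfl
  simp only [totalCost, key, jointLaw_map_window_eq hLJ h h']

variable [∀ j, StandardBorelSpace (B j)] [∀ j, Nonempty (B j)]

/-- The output distributions agree as kernels, not only almost surely, because a conditional
distribution is defined from the joint law alone. -/
theorem outputDist_eq (hLJ : L ≤ J)
    (h : IsWindowPolicy ν Q.toChannel P π)
    (h' : IsWindowPolicy ν Q.toChannel P' π)
    (i : Fin (n + 1)) :
    outputDist ν Q.toChannel P i = outputDist ν Q.toChannel P' i := by
  have key : ∀ P : InputDist A B K n, (jointLaw ν Q.toChannel P i).map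
      (fun z => (Seg.restr (seg_Iio_sub_Iic _) z.2,
        z.2 ⟨((i : ℕ) : ℤ), le_refl ((i : ℕ) : ℤ)⟩)) =
      ((jointLaw ν Q.toChannel P i).map
        fun z => (Seg.restr (seg_Icc_sub_Iic _ J) z.1, z.2)).map
      (fun z => (Seg.restr (seg_Iio_sub_Iic _) z.2,
        z.2 ⟨((i : ℕ) : ℤ), le_refl ((i : ℕ) : ℤ)⟩)) := fun P => by
    rw [Measure.map_map (by fun_prop) (by fun_prop)]
    rfl
  simp only [outputDist, condDistrib, key, jointLaw_map_window_eq hLJ h h']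

instance (C : Channel A B n) (P : InputDist A B K n) (i : Fin (n + 1)) :
    IsMarkovKernel (outputDist ν C P i) := by
  unfold outputDist
  infer_instance

theorem directedInfo_eq_of_isWindowPolicy (hLJ : L ≤ J)
    (h : IsWindowPolicy ν Q.toChannel P π)
    (h' : IsWindowPolicy ν Q.toChannel P' π) :
    directedInfo ν Q.toChannel P = directedInfo ν Q.toChannel P' := by
  have key : ∀ (P : InputDist A B K n) (i : Fin (n + 1)),
      ∫⁻ z, InformationTheory.klDiv ((Q.toChannel i).1 (z.2, z.1))
          (outputDist ν Q.toChannel P i z.2) ∂(inputLaw ν Q.toChannel P i) =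
        ∫⁻ z, InformationTheory.klDiv
            ((Q i).1 (z.2, Seg.restr (Icc_sub_Icc hLJ ((i : ℕ) : ℤ)) z.1))
            (outputDist ν Q.toChannel P i z.2)
          ∂((inputLaw ν Q.toChannel P i).map
            fun z => (Seg.restr (seg_Icc_sub_Iic _ J) z.1, z.2)) := fun P i => by
    rw [lintegral_map _ (by fun_prop)]
    · rfl
    · exact measurable_klDiv_kernel
        ((Q i).1.comap (fun z => (z.2, Seg.restr (Icc_sub_Icc hLJ ((i : ℕ) : ℤ)) z.1))
          (by fun_prop : Measurable fun z : Seg A (Icc (((i : ℕ) : ℤ) - J) ((i : ℕ) : ℤ)) ×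
            Seg B (Iio ((i : ℕ) : ℤ)) => _))
        ((outputDist ν Q.toChannel P i).comap Prod.snd measurable_snd)
  refine Finset.sum_congr rfl fun i _ => ?_
  rw [key, key, inputLaw_map_window_eq hLJ h h', outputDist_eq hLJ h h']

end Agreement

/-! ### Reduction to the class A kernels -/

section ClassA

variable {A B : ℤ → Type*} [∀ j, MeasurableSpace (A j)] [∀ j, MeasurableSpace (B j)]
variable {K : Set ℤ} {L J N n : ℕ}
variable {ν : Measure (Seg A (Iio ((0 : ℕ) : ℤ)) × Seg B (Iio ((0 : ℕ) : ℤ)))}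
variable {C : Channel A B n} {Q : ChannelA A B L n}

theorem outputStep_congr (k : ℕ)
    {c c' : StochKernel (Seg B (Iio (k : ℤ)) × Seg A (Iic (k : ℤ))) (B k)}
    {μ : Measure (Seg A (Iic (k : ℤ)) × Seg B (Iio (k : ℤ)))}
    (h : ∀ᵐ z ∂μ, c.1 (z.2, z.1) = c'.1 (z.2, z.1)) : outputStep k c μ = outputStep k c' μ := by
  unfold outputStep
  rw [Measure.compProd_congr (κ := c.1.comap Prod.swap measurable_swap)
    (η := c'.1.comap Prod.swap measurable_swap) h]

theorem IsClassA.pastLaw_eq (h : IsClassA ν C K Q) (P : InputDist A B K n) (k : ℕ)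
    (hk : k ≤ n + 1) : pastLaw ν C P k hk = pastLaw ν Q.toChannel P k hk := by
  induction k with
  | zero => rfl
  | succ k ih =>
    have := outputStep_congr k (c' := Q.toChannel ⟨k, hk⟩) (h P ⟨k, hk⟩)
    rw [inputLaw] at this
    rw [pastLaw, pastLaw, this, ih]

theorem IsClassA.inputLaw_eq (h : IsClassA ν C K Q) (P : InputDist A B K n) (i : Fin (n + 1)) :
    inputLaw ν C P i = inputLaw ν Q.toChannel P i := by
  rw [inputLaw, inputLaw, h.pastLaw_eq]

theorem IsClassA.jointLaw_eq (h : IsClassA ν C K Q) (P : InputDist A B K n) (i : Fin (n + 1)) :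
    jointLaw ν C P i = jointLaw ν Q.toChannel P i := by
  rw [jointLaw, jointLaw, outputStep_congr i (c' := Q.toChannel i) (h P i), h.inputLaw_eq]

theorem IsClassA.totalCost_eq (h : IsClassA ν C K Q) (P : InputDist A B K n) (γ : CostA A B N n) :
    totalCost ν C P γ = totalCost ν Q.toChannel P γ := by
  simp only [totalCost, h.jointLaw_eq]

theorem mem_costConstrained {γ : CostA A B N n} {κ : ℝ≥0} {P : InputDist A B K n} :
    P ∈ costConstrained ν C K γ κ ↔ totalCost ν C P γ / (n + 1) ≤ κ :=
  Iff.rfl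

theorem Policy.toInput_mem_finiteMemoryInputs (π : Policy A B K J n) :
    π.toInput ∈ finiteMemoryInputs ν C K J :=
  ⟨π, fun _ => Filter.Eventually.of_forall fun _ => rfl⟩

variable [IsProbabilityMeasure ν]
variable [∀ j, StandardBorelSpace (B j)] [∀ j, Nonempty (B j)]

theorem IsClassA.directedInfo_eq (h : IsClassA ν C K Q) (P : InputDist A B K n) :
    directedInfo ν C P = directedInfo ν Q.toChannel P := by
  unfold directedInfo
  refine Finset.sum_congr rfl fun i _ => ?_
  have hout : outputDist ν C P i = outputDist ν Q.toChannel P i := by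
    simp only [outputDist, h.jointLaw_eq]
  rw [hout, ← h.inputLaw_eq]
  refine lintegral_congr_ae ?_
  filter_upwards [h P i] with z hz
  rw [hz]
  rfl

/-- Every input distribution has the directed information, and for `N ≤ J` the cost, of some policy
of memory `J ≥ L`. -/
theorem exists_policy_eq [∀ j, StandardBorelSpace (A j)] [∀ j, Nonempty (A j)]
    (hK : IsUpperSet K) (h : IsClassA ν C K Q) (hLJ : L ≤ J)
    (P : InputDist A B K n) : ∃ π : Policy A B K J n,
      directedInfo ν C π.toInput = directedInfo ν C P ∧
      (N ≤ J → ∀ γ : CostA A B N n, (∀ i, Measurable (γ i)) →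
        totalCost ν C π.toInput γ = totalCost ν C P γ) := by
  obtain ⟨π, hπ⟩ := exists_isWindowPolicy ν hK J Q.toChannel P
  refine ⟨π, ?_, fun hNJ γ hγ => ?_⟩
  · rw [h.directedInfo_eq, h.directedInfo_eq]
    exact directedInfo_eq_of_isWindowPolicy hLJ (isWindowPolicy_toInput ν _ π) hπ
  · rw [h.totalCost_eq, h.totalCost_eq]
    exact totalCost_eq_of_isWindowPolicy hLJ hNJ (isWindowPolicy_toInput ν _ π) hπ hγ

end ClassA

/-! ### Output distributions and the a posteriori recursion -/

section Filter

variable {A B : ℤ → Type*} [∀ j, MeasurableSpace (A j)] [∀ j, MeasurableSpace (B j)]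
variable {K : Set ℤ} {L J n : ℕ}

theorem self_mem_Iio_succ (k : ℕ) : (k : ℤ) ∈ Iio (((k + 1 : ℕ)) : ℤ) := by
  simp

theorem Iio_sub_Iio_succ (k : ℕ) : Iio (k : ℤ) ⊆ Iio (((k + 1 : ℕ)) : ℤ) :=
  Iio_subset_Iio (by simp)

/-- The Bayes numerator `T(db_k, da_{k+1-J}^k)` as a kernel in `b^{k-1}`, when the distribution of
`a_{k-J}^{k-1}` is given by a kernel `η` in `b^{k-1}`. -/
def bayesKernel (hLJ : L ≤ J) (k : ℕ)
    (q : StochKernel (Seg B (Iio (k : ℤ)) × Seg A (Icc ((k : ℤ) - L) k)) (B k))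
    (p : StochKernel (Seg A (K ∩ Ico ((k : ℤ) - J) k) × Seg B (Iio (k : ℤ))) (A k))
    (η : Kernel (Seg B (Iio (k : ℤ))) (Seg A (Ico ((k : ℤ) - J) k))) :
    Kernel (Seg B (Iio (k : ℤ)))
      (B k × Seg A (Ico (((k + 1 : ℕ) : ℤ) - J) ((k + 1 : ℕ) : ℤ))) :=
  ((η ⊗ₖ p.1.comap (fun z => (Seg.restr inter_subset_right z.2, z.1)) (by fun_prop)) ⊗ₖ
      q.1.comap (fun z => (z.1, Seg.extend (k : ℤ) (seg_Icc_sub_insert hLJ k) z.2.1 z.2.2))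
        (by fun_prop)).map
    fun z => (z.2, Seg.extend (k : ℤ) (seg_Ico_succ_sub_insert J k) z.1.1 z.1.2)

section

variable (hLJ : L ≤ J) (k : ℕ)
    (q : StochKernel (Seg B (Iio (k : ℤ)) × Seg A (Icc ((k : ℤ) - L) k)) (B k))
    (p : StochKernel (Seg A (K ∩ Ico ((k : ℤ) - J) k) × Seg B (Iio (k : ℤ))) (A k))
    (η : Kernel (Seg B (Iio (k : ℤ))) (Seg A (Ico ((k : ℤ) - J) k))) [IsMarkovKernel η]

instance : IsMarkovKernel (bayesKernel hLJ k q p η) :=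
  Kernel.IsMarkovKernel.map _ (by fun_prop)

theorem bayesKernel_apply (s : Seg B (Iio (k : ℤ))) :
    bayesKernel hLJ k q p η s = bayesNumerator hLJ k q p s (η s) := by
  rw [bayesKernel, Kernel.map_apply _ (by fun_prop), Kernel.compProd_apply_eq_compProd_sectR,
    Kernel.compProd_apply_eq_compProd_sectR]
  rfl

theorem bayesNumerator_fst_apply (s : Seg B (Iio (k : ℤ)))
    (ξ : Measure (Seg A (Ico ((k : ℤ) - J) k))) [IsFiniteMeasure ξ] {E : Set (B k)}
    (hE : MeasurableSet E) :
    (bayesNumerator hLJ k q p s ξ).fst E =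
      ∫⁻ w, ∫⁻ a, q.1 (s, Seg.extend _ (seg_Icc_sub_insert hLJ _) w a) E
        ∂(p.1 (Seg.restr inter_subset_right w, s)) ∂ξ := by
  rw [bayesNumerator, Measure.fst, Measure.map_map (by fun_prop) (by fun_prop),
    Measure.map_apply (by fun_prop) hE, Measure.compProd_apply (hE.preimage (by fun_prop)),
    Measure.lintegral_compProd]
  · rfl
  · exact Kernel.measurable_kernel_prodMk_left (hE.preimage (by fun_prop))

/-- If `η` disintegrates the law `m` of the window `(A_{k-J}^{k-1}, B^{k-1})` along `B^{k-1}`, then the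
Bayes kernel disintegrates the law of `(B^{k-1}, (B_k, A_{k+1-J}^k))`. -/
theorem map_compProd_eq_compProd_bayesKernel
    {m : Measure (Seg A (Ico ((k : ℤ) - J) k) × Seg B (Iio (k : ℤ)))} [IsProbabilityMeasure m]
    (hη : m.map Prod.swap = m.map Prod.snd ⊗ₘ η) :
    ((m ⊗ₘ windowInput k p).map
        (fun z => (Seg.extend (k : ℤ) (Icc_sub_insert_Ico _ J) z.1.1 z.2, z.1.2)) ⊗ₘ
      q.1.comap (fun z => (z.2, Seg.restr (Icc_sub_Icc hLJ (k : ℤ)) z.1)) (by fun_prop)).map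
      (fun z => (z.1.2, (z.2, Seg.restr (Ico_succ_sub_Icc J k) z.1.1))) =
      m.map Prod.snd ⊗ₘ bayesKernel hLJ k q p η := by
  have hm : m = (m.map Prod.snd ⊗ₘ η).map Prod.swap := by
    rw [← hη, Measure.map_map measurable_swap measurable_swap]
    simp
  have : IsProbabilityMeasure (m.map Prod.snd) :=
    Measure.isProbabilityMeasure_map measurable_snd.aemeasurable
  refine Measure.ext_of_lintegral _ fun f hf => ?_
  -- measurability of the integrals over `b_k`, then over `a_k`, that the expansion produces
  have hb : Measurable fun z : Seg A (Icc ((k : ℤ) - J) k) × Seg B (Iio (k : ℤ)) =>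
      ∫⁻ b, f (z.2, (b, Seg.restr (Ico_succ_sub_Icc J k) z.1)) ∂(q.1.comap
        (fun z => (z.2, Seg.restr (Icc_sub_Icc hLJ (k : ℤ)) z.1)) (by fun_prop) z) :=
    Measurable.lintegral_kernel_prod_right'
      (f := fun u : (Seg A (Icc ((k : ℤ) - J) k) × Seg B (Iio (k : ℤ))) × B (k : ℤ) =>
        f (u.1.2, (u.2, Seg.restr (Ico_succ_sub_Icc J k) u.1.1))) (by fun_prop)
  have ha := hb.comp (by fun_prop : Measurable
    fun z : (Seg A (Ico ((k : ℤ) - J) k) × Seg B (Iio (k : ℤ))) × A (k : ℤ) =>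
      (Seg.extend (k : ℤ) (Icc_sub_insert_Ico _ J) z.1.1 z.2, z.1.2))
  have hw := Measurable.lintegral_kernel_prod_right' (κ := windowInput k p) ha
  conv_lhs => rw [hm]
  rw [lintegral_map hf (by fun_prop), Measure.lintegral_compProd (by fun_prop),
    lintegral_map ?_ (by fun_prop), Measure.lintegral_compProd ?_,
    lintegral_map ?_ (by fun_prop), Measure.lintegral_compProd ?_,
    Measure.lintegral_compProd hf]
  · refine lintegral_congr fun s => ?_
    rw [bayesKernel, Kernel.lintegral_map _ (by fun_prop) _ (by fun_prop),
      Kernel.lintegral_compProd _ _ _ (by fun_prop), Kernel.lintegral_compProd]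
    · refine lintegral_congr fun w => lintegral_congr fun a => ?_
      simp only [Kernel.comap_apply, Prod.swap_prod_mk]
      rw [Seg.restr_extend _ _ _ subset_rfl (seg_Icc_sub_insert hLJ k)]
      rw [Seg.restr_extend _ _ _ subset_rfl (seg_Ico_succ_sub_insert J k)]
      rfl
    · exact Measurable.lintegral_kernel_prod_right''
        (f := fun u : (Seg A (Ico ((k : ℤ) - J) k) × A (k : ℤ)) × B (k : ℤ) =>
          f (s, u.2, Seg.extend (k : ℤ) _ u.1.1 u.1.2)) (by fun_prop)
  · exact hw.comp measurable_swap
  · exact hw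
  · exact ha
  · exact hb

end

variable {ν : Measure (Seg A (Iio ((0 : ℕ) : ℤ)) × Seg B (Iio ((0 : ℕ) : ℤ)))}
variable [IsProbabilityMeasure ν]
variable [∀ j, StandardBorelSpace (A j)] [∀ j, Nonempty (A j)]

theorem jointLaw_map_eq_compProd_bayesKernel (hLJ : L ≤ J) (Q : ChannelA A B L n)
    (π : Policy A B K J n) (i : Fin (n + 1)) :
    (jointLaw ν Q.toChannel π.toInput i).map (fun z => (Seg.restr (seg_Iio_sub_Iic _) z.2,
        (z.2 ⟨((i : ℕ) : ℤ), le_refl ((i : ℕ) : ℤ)⟩,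
          Seg.restr ((Ico_succ_sub_Icc J i).trans (seg_Icc_sub_Iic _ J)) z.1))) =
      outputPastLaw ν Q.toChannel π.toInput i i.2.le ⊗ₘ bayesKernel hLJ i (Q i) (π i)
        (posteriorDist ν Q.toChannel π.toInput J i i.2.le) := by
  set μ := pastLaw ν Q.toChannel π.toInput i i.2.le
  have hsnd : (pastWindow J i μ).map Prod.snd =
      outputPastLaw ν Q.toChannel π.toInput i i.2.le := by
    rw [pastWindow, outputPastLaw, Measure.map_map (by fun_prop) (by fun_prop)]
    rfl
  have hη : (pastWindow J i μ).map Prod.swap = (pastWindow J i μ).map Prod.snd ⊗ₘ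
      posteriorDist ν Q.toChannel π.toInput J i i.2.le := by
    rw [hsnd, outputPastLaw, posteriorDist, compProd_map_condDistrib (by fun_prop), pastWindow,
      Measure.map_map (by fun_prop) (by fun_prop)]
    rfl
  rw [← hsnd, ← map_compProd_eq_compProd_bayesKernel hLJ i (Q i) (π i) _ hη,
    ← inputLaw_map_window ν _ _ _ _ (isWindowPolicy_toInput ν Q.toChannel π i)]
  have h := congrArg (fun m => m.map fun z => (Seg.restr (seg_Iio_sub_Iic ((i : ℕ) : ℤ)) z.2,
    (z.2 ⟨((i : ℕ) : ℤ), le_refl ((i : ℕ) : ℤ)⟩, Seg.restr (Ico_succ_sub_Icc J i) z.1)))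
    (jointLaw_map_window ν hLJ Q π.toInput i)
  dsimp only at h
  rw [Measure.map_map (by fun_prop) (by fun_prop),
    Measure.map_map (by fun_prop) (by fun_prop)] at h
  refine h.trans (congrArg₂ Measure.map ?_ rfl)
  funext z
  exact Prod.ext (Seg.restr_extend_of_notMem ((i : ℕ) : ℤ) (seg_Iic_sub _) (seg_Iio_sub_Iic _)
    subset_rfl (by simp) _ _)
    (Prod.ext (Seg.extend_self ((i : ℕ) : ℤ) (seg_Iic_sub _) z.1.2 z.2 (mem_Iic.2 le_rfl)) rfl)

theorem jointLaw_map_outputPast (hLJ : L ≤ J) (Q : ChannelA A B L n)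
    (π : Policy A B K J n) (i : Fin (n + 1)) :
    (jointLaw ν Q.toChannel π.toInput i).map (fun z => Seg.restr (seg_Iio_sub_Iic _) z.2) =
      outputPastLaw ν Q.toChannel π.toInput i i.2.le := by
  have h := congrArg Measure.fst (jointLaw_map_eq_compProd_bayesKernel (ν := ν) hLJ Q π i)
  rw [outputPastLaw] at h ⊢
  rwa [Measure.fst_compProd, Measure.fst, Measure.map_map (by fun_prop) (by fun_prop)] at h

variable [∀ j, StandardBorelSpace (B j)] [∀ j, Nonempty (B j)]

instance (C : Channel A B n) (P : InputDist A B K n) (k : ℕ) (hk : k ≤ n + 1) :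
    IsProbabilityMeasure (outputPastLaw ν C P k hk) :=
  Measure.isProbabilityMeasure_map measurable_snd.aemeasurable

theorem outputDist_ae_eq_bayesNumerator_fst (hLJ : L ≤ J) (Q : ChannelA A B L n)
    (π : Policy A B K J n) (i : Fin (n + 1)) :
    ∀ᵐ s ∂(outputPastLaw ν Q.toChannel π.toInput i i.2.le),
      outputDist ν Q.toChannel π.toInput i s = (bayesNumerator hLJ i (Q i) (π i) s
        (posteriorDist ν Q.toChannel π.toInput J i i.2.le s)).fst := by
  have h := condDistrib_ae_eq_of_measure_eq_compProd_of_measurable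
    (X := fun z => Seg.restr (seg_Iio_sub_Iic ((i : ℕ) : ℤ)) z.2)
    (Y := fun z => z.2 ⟨((i : ℕ) : ℤ), le_refl ((i : ℕ) : ℤ)⟩)
    (μ := jointLaw ν Q.toChannel π.toInput i)
    (κ := (bayesKernel hLJ i (Q i) (π i)
      (posteriorDist ν Q.toChannel π.toInput J i i.2.le)).map Prod.fst)
    (by fun_prop) (by fun_prop) ?_
  · rw [jointLaw_map_outputPast hLJ] at h
    filter_upwards [h] with s hs
    rw [outputDist, hs, Kernel.map_apply _ measurable_fst, bayesKernel_apply, Measure.fst]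
  · rw [jointLaw_map_outputPast hLJ, Measure.compProd_map measurable_fst,
      ← jointLaw_map_eq_compProd_bayesKernel, Measure.map_map (by fun_prop) (by fun_prop)]
    rfl

theorem outputFormula_toInput (hLJ : L ≤ J) (Q : ChannelA A B L n) (π : Policy A B K J n) :
    OutputFormula ν hLJ Q π := fun i => by
  filter_upwards [outputDist_ae_eq_bayesNumerator_fst hLJ Q π i] with s hs E hE
  rw [hs, bayesNumerator_fst_apply _ _ _ _ _ _ hE]

/-- Both sides are conditional distributions of `(B_i, A_{i+1-J}^i)` given `B^{i-1}`: on the right, `B_i`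
is drawn first and then the window given `B^i`. -/
theorem bayesKernel_ae_eq_compProd (hLJ : L ≤ J) (Q : ChannelA A B L n)
    (π : Policy A B K J n) (i : Fin (n + 1)) :
    bayesKernel hLJ i (Q i) (π i)
        (posteriorDist ν Q.toChannel π.toInput J i (i.2.le))
      =ᵐ[outputPastLaw ν Q.toChannel π.toInput i (i.2.le)]
      (outputDist ν Q.toChannel π.toInput i) ⊗ₖ
        (posteriorDist ν Q.toChannel π.toInput J (i + 1) i.2).comap
          (fun z => Seg.extend ((i : ℕ) : ℤ) (seg_Iio_succ_sub_insert i) z.1 z.2) (by fun_prop) := by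
  refine Kernel.ae_eq_of_compProd_eq ?_
  set β := outputPastLaw ν Q.toChannel π.toInput i (i.2.le)
  set Λ := jointLaw ν Q.toChannel π.toInput i
  set post := posteriorDist ν Q.toChannel π.toInput J (i + 1) i.2 with hpost
  have hjoint : β ⊗ₘ outputDist ν Q.toChannel π.toInput i =
      Λ.map fun z => (Seg.restr (seg_Iio_sub_Iic ((i : ℕ) : ℤ)) z.2,
        z.2 ⟨((i : ℕ) : ℤ), le_refl ((i : ℕ) : ℤ)⟩) := by
    rw [← compProd_map_condDistrib (by fun_prop), jointLaw_map_outputPast hLJ]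
    rfl
  -- split `b^i` into `(b^{i-1}, b_i)`, the inverse of extending `b^{i-1}` by `b_i`
  have hsplit : Measurable fun x : Seg B (Iio ((((i : ℕ) + 1 : ℕ)) : ℤ)) =>
      (Seg.restr (Iio_sub_Iio_succ i) x, x ⟨((i : ℕ) : ℤ), self_mem_Iio_succ i⟩) := by fun_prop
  have hpost' : (post.comap (fun z => Seg.extend ((i : ℕ) : ℤ) (seg_Iio_succ_sub_insert i) z.1 z.2)
      (by fun_prop)).comap _ hsplit = post := by
    ext1 x
    rw [Kernel.comap_apply, Kernel.comap_apply,
      Seg.extend_restr (X := B) ((i : ℕ) : ℤ) (seg_Iio_succ_sub_insert i) (Iio_sub_Iio_succ i)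
        subset_rfl
        (self_mem_Iio_succ i) x]
    rfl
  have hnext : outputPastLaw ν Q.toChannel π.toInput (i + 1) i.2 ⊗ₘ post =
      Λ.map fun z => (Seg.restr (seg_Iio_succ_sub i) z.2,
        Seg.restr ((Ico_succ_sub_Icc J i).trans (seg_Icc_sub_Iic _ J)) z.1) := by
    rw [outputPastLaw, hpost, posteriorDist, compProd_map_condDistrib (by fun_prop), pastLaw,
      Measure.map_map (by fun_prop) (by fun_prop)]
    rfl
  have hout : (outputPastLaw ν Q.toChannel π.toInput (i + 1) i.2).map
      (fun x => (Seg.restr (Iio_sub_Iio_succ i) x, x ⟨((i : ℕ) : ℤ), self_mem_Iio_succ i⟩)) =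
      β ⊗ₘ outputDist ν Q.toChannel π.toInput i := by
    rw [hjoint, outputPastLaw, pastLaw, Measure.map_map (by fun_prop) (by fun_prop),
      Measure.map_map (by fun_prop) (by fun_prop)]
    rfl
  have h := map_compProd_comap (outputPastLaw ν Q.toChannel π.toInput (i + 1) i.2)
    (post.comap (fun z => Seg.extend ((i : ℕ) : ℤ) (seg_Iio_succ_sub_insert i) z.1 z.2)
      (by fun_prop)) hsplit
  rw [hpost', hnext, hout, Measure.map_map (by fun_prop) (by fun_prop)] at h
  rw [← jointLaw_map_eq_compProd_bayesKernel hLJ Q π i, ← Measure.compProd_assoc', ← h,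
    Measure.map_map (by fun_prop) (by fun_prop)]
  rfl

theorem posteriorDist_succ_ae_eq_bayesUpdate (hLJ : L ≤ J) (Q : ChannelA A B L n)
    (π : Policy A B K J n) (i : Fin (n + 1)) :
    ∀ᵐ s ∂(outputPastLaw ν Q.toChannel π.toInput i i.2.le),
      ∀ᵐ b ∂(outputDist ν Q.toChannel π.toInput i s),
        posteriorDist ν Q.toChannel π.toInput J (i + 1) i.2
            (Seg.extend ((i : ℕ) : ℤ) (seg_Iio_succ_sub_insert i) s b) =
          bayesUpdate hLJ i (Q i) (π i) s
            (posteriorDist ν Q.toChannel π.toInput J i i.2.le s) b := by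
  filter_upwards [bayesKernel_ae_eq_compProd (ν := ν) hLJ Q π i,
    outputDist_ae_eq_bayesNumerator_fst (ν := ν) hLJ Q π i] with s hs hfst
  rw [bayesKernel_apply, Kernel.compProd_apply_eq_compProd_sectR, hfst] at hs
  rw [hfst]
  exact eq_condKernel_of_measure_eq_compProd _ hs

theorem posteriorRecursion_toInput (hLJ : L ≤ J) (Q : ChannelA A B L n) (π : Policy A B K J n) :
    PosteriorRecursion ν hLJ Q π :=
  ⟨Filter.Eventually.of_forall fun _ => rfl,
    fun k _ => posteriorDist_succ_ae_eq_bayesUpdate hLJ Q π ⟨k, by omega⟩⟩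

end Filter

end

theorem mainTheorem1
    (A B : ℤ → Type*)
    [∀ j, MeasurableSpace (A j)] [∀ j, StandardBorelSpace (A j)] [∀ j, Nonempty (A j)]
    [∀ j, MeasurableSpace (B j)] [∀ j, StandardBorelSpace (B j)] [∀ j, Nonempty (B j)]
    (n L N : ℕ)
    -- the times whose input symbols the encoder knows: all times from some time `≤ 0` on, or all
    (K : Set ℤ) (hK : IsUpperSet K) (hK0 : (0 : ℤ) ∈ K)
    -- the law of the initial data `(a^{-1}, b^{-1})`
    (ν : Measure (Seg A (Iio ((0 : ℕ) : ℤ)) × Seg B (Iio ((0 : ℕ) : ℤ)))) [IsProbabilityMeasure ν]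
    (C : Channel A B n) (Q : ChannelA A B L n) (hCQ : IsClassA ν C K Q) :
    -- (a) without transmission cost
    ((∀ P : InputDist A B K n, ∃ P' ∈ finiteMemoryInputs ν C K L,
        directedInfo ν C P ≤ directedInfo ν C P') ∧
      ((∃ P : InputDist A B K n, ∀ P' : InputDist A B K n, directedInfo ν C P' ≤ directedInfo ν C P) →
        ∃ P ∈ finiteMemoryInputs ν C K L, ∀ P' : InputDist A B K n, directedInfo ν C P' ≤ directedInfo ν C P) ∧
      ((⨆ P : InputDist A B K n, directedInfo ν C P) =
        ⨆ π : Policy A B K L n, directedInfo ν Q.toChannel π.toInput) ∧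
      ∀ π : Policy A B K L n,
        (∀ i, jointLaw ν C π.toInput i = jointLaw ν Q.toChannel π.toInput i) ∧
        OutputFormula ν (le_refl L) Q π ∧
        PosteriorRecursion ν (le_refl L) Q π) ∧
    -- (b) with transmission cost
    (∀ γ : CostA A B N n, (∀ i, Measurable (γ i)) → ∀ κ : ℝ≥0, LagrangianDuality ν C K γ κ →
      (∀ P ∈ costConstrained ν C K γ κ,
        ∃ P' ∈ finiteMemoryInputs ν C K (max L N) ∩ costConstrained ν C K γ κ,
          directedInfo ν C P ≤ directedInfo ν C P') ∧
      ((∃ P ∈ costConstrained ν C K γ κ,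
          ∀ P' ∈ costConstrained ν C K γ κ, directedInfo ν C P' ≤ directedInfo ν C P) →
        ∃ P ∈ finiteMemoryInputs ν C K (max L N) ∩ costConstrained ν C K γ κ,
          ∀ P' ∈ costConstrained ν C K γ κ, directedInfo ν C P' ≤ directedInfo ν C P) ∧
      ((⨆ P ∈ costConstrained ν C K γ κ, directedInfo ν C P) =
        ⨆ π ∈ {π : Policy A B K (max L N) n |
            totalCost ν Q.toChannel π.toInput γ / (n + 1) ≤ κ},
          directedInfo ν Q.toChannel π.toInput) ∧
      ∀ π : Policy A B K (max L N) n,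
        totalCost ν Q.toChannel π.toInput γ / (n + 1) ≤ κ →
        (∀ i, jointLaw ν C π.toInput i = jointLaw ν Q.toChannel π.toInput i) ∧
        OutputFormula ν (le_max_left L N) Q π ∧
        PosteriorRecursion ν (le_max_left L N) Q π)
 := by
  have sound : ∀ {J : ℕ} (hLJ : L ≤ J) (π : Policy A B K J n),
      (∀ i, jointLaw ν C π.toInput i = jointLaw ν Q.toChannel π.toInput i) ∧
        OutputFormula ν hLJ Q π ∧ PosteriorRecursion ν hLJ Q π := fun hLJ π =>
    ⟨hCQ.jointLaw_eq π.toInput, outputFormula_toInput hLJ Q π, posteriorRecursion_toInput hLJ Q π⟩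
  refine ⟨⟨fun P => ?_, ?_, ?_, sound le_rfl⟩, fun γ hγ κ _ =>
    ⟨fun P hP => ?_, ?_, ?_, fun π _ => sound (le_max_left L N) π⟩⟩
  · obtain ⟨π, hπ, -⟩ := exists_policy_eq (N := N) hK hCQ le_rfl P
    exact ⟨_, π.toInput_mem_finiteMemoryInputs, hπ.ge⟩
  · rintro ⟨P, hP⟩
    obtain ⟨π, hπ, -⟩ := exists_policy_eq (N := N) hK hCQ le_rfl P
    exact ⟨_, π.toInput_mem_finiteMemoryInputs, fun P' => hπ ▸ hP P'⟩
  · refine le_antisymm (iSup_le fun P => ?_) (iSup_le fun π => ?_)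
    · obtain ⟨π, hπ, -⟩ := exists_policy_eq (N := N) hK hCQ le_rfl P
      rw [← hπ, hCQ.directedInfo_eq]
      exact le_iSup (fun π : Policy A B K L n => directedInfo ν Q.toChannel π.toInput) π
    · rw [← hCQ.directedInfo_eq]
      exact le_iSup (fun P => directedInfo ν C P) π.toInput
  · obtain ⟨π, hπ, hcost⟩ := exists_policy_eq (N := N) hK hCQ (le_max_left L N) P
    refine ⟨π.toInput, ⟨π.toInput_mem_finiteMemoryInputs, ?_⟩, hπ.ge⟩
    rw [mem_costConstrained, hcost (le_max_right L N) γ hγ]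
    exact hP
  · rintro ⟨P, hPκ, hP⟩
    obtain ⟨π, hπ, hcost⟩ := exists_policy_eq (N := N) hK hCQ (le_max_left L N) P
    refine ⟨π.toInput, ⟨π.toInput_mem_finiteMemoryInputs, ?_⟩, fun P' hP' => hπ ▸ hP P' hP'⟩
    rw [mem_costConstrained, hcost (le_max_right L N) γ hγ]
    exact hPκ
  · refine le_antisymm (iSup₂_le fun P hP => ?_) (iSup₂_le fun π hπ => ?_)
    · obtain ⟨π, hπ, hcost⟩ := exists_policy_eq (N := N) hK hCQ (le_max_left L N) P
      have hπκ : totalCost ν Q.toChannel π.toInput γ / (n + 1) ≤ κ := by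
        rw [← hCQ.totalCost_eq, hcost (le_max_right L N) γ hγ]
        exact hP
      rw [← hπ, hCQ.directedInfo_eq]
      exact le_iSup₂ (f := fun (π : Policy A B K (max L N) n)
        (_ : π ∈ {π : Policy A B K (max L N) n |
          totalCost ν Q.toChannel π.toInput γ / (n + 1) ≤ κ}) =>
        directedInfo ν Q.toChannel π.toInput) π hπκ
    · have hπκ : π.toInput ∈ costConstrained ν C K γ κ := by
        rw [mem_costConstrained, hCQ.totalCost_eq]
        exact hπ
      rw [← hCQ.directedInfo_eq]
      exact le_iSup₂ (f := fun P (_ : P ∈ costConstrained ν C K γ κ) => directedInfo ν C P) _ hπκ
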